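/- A symmetric norm is a norm $\|\cdot\|$ on square complex matrices of every finite size such that $\|UXV\|=\|X\|$ for all $X$ and all unitaries $U,V$ of the same size, and $\|X\oplus 0\|=\|X\|$ for zero blocks of any size (so that matrices of different sizes can be compared). For a square complex matrix $X$ put $|X|=(X^*X)^{1/2}$, and let $f(|X|)$ be defined by functional calculus. A function $f$ on $[0,\infty)$ is e-convex if $t\mapsto f(e^t)$ is convex on $(-\infty,\infty)$. Theorem 2.5. Let $\mathbb{A}=[A_{i,j}]_{1\le i,j\le m}$ be a Hermitian $mn\times mn$ complex matrix partitioned into $m^2$ blocks $A_{i,j}$, each of size $n\times n$, and let $f:[0,\infty)\to[0,\infty)$ be concave and e-convex. Then, for all symmetric norms, $$\|f(|\mathbb{A}|)\|\le\Big\|\sum_{i,j=1}^m f(|A_{i,j}|)\Big\|.$$ -/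

import Mathlib

open scoped MatrixOrder

/-- A symmetric (unitarily invariant) norm `‖·‖`, evaluated on square complex matrices of every
finite size. As usual, a single norm is applied to matrices of different sizes by identifying
`X` with `X ⊕ 0`; the names of the row and column indices do not matter. -/
structure SymmetricNorm where
  toFun : ∀ (ι : Type) [Fintype ι], Matrix ι ι ℂ → ℝ
  eq_zero_of_toFun_eq_zero : ∀ (ι : Type) [Fintype ι] (X : Matrix ι ι ℂ),
    toFun ι X = 0 → X = 0
  add_le : ∀ (ι : Type) [Fintype ι] (X Y : Matrix ι ι ℂ),
    toFun ι (X + Y) ≤ toFun ι X + toFun ι Y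
  smul_eq : ∀ (ι : Type) [Fintype ι] (c : ℂ) (X : Matrix ι ι ℂ),
    toFun ι (c • X) = ‖c‖ * toFun ι X
  unitarily_invariant : ∀ (ι : Type) [Fintype ι] [DecidableEq ι] (U V X : Matrix ι ι ℂ),
    U ∈ Matrix.unitaryGroup ι ℂ → V ∈ Matrix.unitaryGroup ι ℂ →
      toFun ι (U * X * V) = toFun ι X
  reindex_eq : ∀ (ι κ : Type) [Fintype ι] [Fintype κ] (e : ι ≃ κ) (X : Matrix ι ι ℂ),
    toFun κ (Matrix.reindex e e X) = toFun ι X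
  direct_sum_zero : ∀ (ι κ : Type) [Fintype ι] [Fintype κ] (X : Matrix ι ι ℂ),
    toFun (ι ⊕ κ) (Matrix.fromBlocks X 0 0 0) = toFun ι X

/-- `f` is e-convex on `[0, ∞)`: the function `t ↦ f (e ^ t)` is convex on the real line. -/
def EConvex (f : ℝ → ℝ) : Prop :=
  ConvexOn ℝ Set.univ (fun t : ℝ => f (Real.exp t))

/-- `f(|X|)`, where `|X| = (X* X)^{1/2}` is the absolute value of `X` and `f` is applied by
functional calculus; only the values of `f` on `[0, ∞)` matter. -/
noncomputable def funAbs {ι : Type} [Fintype ι] [DecidableEq ι] (f : ℝ → ℝ)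
    (X : Matrix ι ι ℂ) : Matrix ι ι ℂ :=
  cfc f (CFC.abs X)

/-- The `(i, j)` block of a matrix partitioned into `m × m` blocks of size `n × n`. -/
def block {m n : ℕ} (A : Matrix (Fin m × Fin n) (Fin m × Fin n) ℂ) (i j : Fin m) :
    Matrix (Fin n) (Fin n) ℂ :=
  Matrix.of fun a b => A (i, a) (j, b)

/-! Let `Q l` be the block-diagonal matrix with blocks |A_{l,i}|, and P = ∑ₗ `Q l`. Testing ±H ≤ |H|
on the Hermitian dilation H of each block gives -P ≤ A ≤ P (`posSemidef_sub_and_add`). Comparing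
determinants of compressions, the eigenvalues of |A| are weakly log-majorized by those of P
(`prod_abs_le_prod_of_le`).

The two hypotheses on f act separately. Since f is e-convex and nondecreasing, weak log-majorization
becomes weak majorization of f(|A|) by f(P) (`EConvex.sum_le_sum_of_prod_le`). Since f is concave
and nonnegative, the sum of the k largest eigenvalues of f(P) is at most the trace of ∑ₗ f(`Q l`)
compressed to the top k eigenvectors of P (`sum_concave_eigenvalues_le`).

Finally ∑ₗ f(`Q l`) is the direct sum of the X_i = ∑ₗ f(|A_{l,i}|). Ky Fan dominance and pinching
bound ‖f(|A|)‖ by ‖⊕ X_i‖, and `toFun_directSum_le` bounds this by ‖∑ X_i‖. -/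

/-! ### Scalar inequalities for concave and e-convex functions -/

theorem ConcaveOn.monotoneOn_Ici_of_nonneg {f : ℝ → ℝ} (hc : ConcaveOn ℝ (Set.Ici 0) f)
    (h0 : ∀ t, 0 ≤ t → 0 ≤ f t) : MonotoneOn f (Set.Ici 0) := by
  intro s hs t ht hst
  by_contra! hlt
  have hs' : (0 : ℝ) ≤ s := hs
  have hne : s < t := lt_of_le_of_ne hst (by rintro rfl; exact lt_irrefl _ hlt)
  set δ := f s - f t with hδ
  have hδ0 : 0 < δ := by simp only [hδ]; linarith
  -- The line through the points of the graph at s and t reaches zero at t + f(t)(t - s)/δ; the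
  -- extra 1 makes it negative at u, and concavity keeps f(u) below it.
  set u := t + (f t * (t - s) + 1) / δ with hu
  have hft := h0 t ht
  have hut : 0 < u - t := by
    have : 0 < (f t * (t - s) + 1) / δ := by
      apply div_pos _ hδ0
      nlinarith
    linarith
  have hu0 : (0 : ℝ) ≤ u := by linarith [show (0 : ℝ) ≤ t from ht]
  have hsu : 0 < u - s := by linarith
  have key := hc.2 hs (show u ∈ Set.Ici (0 : ℝ) from hu0)
    (show 0 ≤ (u - t) / (u - s) by positivity) (show 0 ≤ (t - s) / (u - s) by
      apply div_nonneg _ hsu.le; linarith) (by field_simp; ring)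
  have e : ((u - t) / (u - s)) • s + ((t - s) / (u - s)) • u = t := by
    simp only [smul_eq_mul]; field_simp; ring
  rw [e] at key
  simp only [smul_eq_mul] at key
  have h1 : (u - t) / (u - s) * f s ≤ f t := by
    have : 0 ≤ (t - s) / (u - s) * f u :=
      mul_nonneg (div_nonneg (by linarith) hsu.le) (h0 u hu0)
    linarith
  rw [div_mul_eq_mul_div, div_le_iff₀ hsu] at h1
  have h2 : (u - t) * δ = f t * (t - s) + 1 := by
    rw [hu]; field_simp; ring
  nlinarith

/-- Concavity between 0 and b, dropping the term in f(0) ≥ 0. In effect f(t)/t is nonincreasing for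
t > 0. -/
theorem ConcaveOn.div_mul_le_of_nonneg_zero {f : ℝ → ℝ} (hc : ConcaveOn ℝ (Set.Ici 0) f)
    (h0 : 0 ≤ f 0) {a b : ℝ} (ha : 0 ≤ a) (hab : a ≤ b) (hb : 0 < b) :
    a / b * f b ≤ f a := by
  have key := hc.2 (Set.mem_Ici.2 le_rfl) (show b ∈ Set.Ici (0 : ℝ) from hb.le)
    (show 0 ≤ 1 - a / b by rw [sub_nonneg, div_le_one hb]; exact hab)
    (show 0 ≤ a / b by positivity) (by ring)
  have e : (1 - a / b) • (0 : ℝ) + (a / b) • b = a := by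
    simp only [smul_eq_mul]; field_simp; ring
  rw [e] at key
  simp only [smul_eq_mul] at key
  have : 0 ≤ (1 - a / b) * f 0 := mul_nonneg (by rw [sub_nonneg, div_le_one hb]; exact hab) h0
  linarith

/-- Abel summation: nonnegative prefix sums are preserved by nonincreasing nonnegative weights. -/
theorem Fin.sum_mul_nonneg_of_antitone {d : ℕ} (c z : Fin d → ℝ) (hc : Antitone c)
    (hc0 : ∀ i, 0 ≤ c i)
    (hz : ∀ (k : ℕ) (hk : k ≤ d), 0 ≤ ∑ i : Fin k, z (Fin.castLE hk i)) :
    0 ≤ ∑ i, c i * z i := by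
  induction d with
  | zero => simp
  | succ d ih =>
    have h1 := ih (fun i => c i.castSucc - c (Fin.last d)) (fun i => z i.castSucc)
      (fun i j hij => by
        have := hc (Fin.castSucc_le_castSucc_iff.2 hij)
        simpa using this)
      (fun i => sub_nonneg.2 (hc (Fin.le_last _)))
      (fun k hk => hz k (hk.trans (Nat.le_succ d)))
    have h2 := mul_nonneg (hc0 (Fin.last d)) (hz (d + 1) le_rfl)
    -- Each weight is its excess over the last (smallest) one plus that constant, which multiplies
    -- the full sum.
    have h3 : ∑ i, c i * z i = ∑ i : Fin d, (c i.castSucc - c (Fin.last d)) * z i.castSucc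
        + c (Fin.last d) * ∑ i : Fin (d + 1), z (Fin.castLE le_rfl i) := by
      simp only [Fin.sum_univ_castSucc, Fin.castLE_rfl, id, sub_mul, Finset.sum_sub_distrib,
        mul_add, Finset.mul_sum]
      ring
    rw [h3]; linarith

/-- The right derivative is a subgradient; it exists everywhere and is nondecreasing in s, so it can
supply monotone weights for Abel summation. -/
theorem ConvexOn.add_rightDeriv_mul_le {φ : ℝ → ℝ} (hφ : ConvexOn ℝ Set.univ φ) (s t : ℝ) :
    φ s + derivWithin φ (Set.Ioi s) s * (t - s) ≤ φ t := by
  rcases lt_trichotomy s t with h | rfl | h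
  · have := hφ.rightDeriv_le_slope_of_mem_interior (by simp) (Set.mem_univ t) h
    rw [slope_def_field, le_div_iff₀ (by linarith)] at this
    linarith
  · simp
  · have h1 := hφ.slope_le_leftDeriv_of_mem_interior (Set.mem_univ t) (by simp) h
    have h2 := hφ.leftDeriv_le_rightDeriv_of_mem_interior (x := s) (by simp)
    have h3 := h1.trans h2
    rw [slope_def_field, div_le_iff₀ (by linarith)] at h3
    linarith

/-- Weak log-majorization implies weak majorization of the images under an e-convex function. -/
theorem EConvex.sum_le_sum_of_prod_le {f : ℝ → ℝ} (hf : EConvex f)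
    (hm : MonotoneOn f (Set.Ici 0)) {d : ℕ} (x p : Fin d → ℝ) (hx : Antitone x)
    (hx0 : ∀ i, 0 ≤ x i) (hp0 : ∀ i, 0 ≤ p i)
    (h : ∀ (k : ℕ) (hk : k ≤ d),
      ∏ i : Fin k, x (Fin.castLE hk i) ≤ ∏ i : Fin k, p (Fin.castLE hk i)) :
    ∑ i, f (x i) ≤ ∑ i, f (p i) := by
  induction d with
  | zero => simp
  | succ d ih =>
    -- Logarithms need positivity. If the last x is 0, its term is handled by monotonicity and the
    -- rest by induction; otherwise every x, and through the full product every p, is positive.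
    rcases (hx0 (Fin.last d)).eq_or_lt with h0 | h0
    · rw [Fin.sum_univ_castSucc, Fin.sum_univ_castSucc]
      refine add_le_add (ih (fun i => x i.castSucc) (fun i => p i.castSucc)
        (fun i j hij => hx (Fin.castSucc_le_castSucc_iff.2 hij)) (fun i => hx0 _) (fun i => hp0 _)
        (fun k hk => h k (hk.trans (Nat.le_succ d)))) ?_
      rw [← h0]
      exact hm (Set.mem_Ici.2 le_rfl) (hp0 _) (hp0 _)
    · have hxp : ∀ i, 0 < x i := fun i => h0.trans_le (hx (Fin.le_last i))
      have hpp : ∀ i, 0 < p i := by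
        have h1 : 0 < ∏ i, p i :=
          (Finset.prod_pos fun i _ => hxp i).trans_le (by simpa using h (d + 1) le_rfl)
        intro i
        refine (hp0 i).lt_of_ne' fun hi => ?_
        rw [Finset.prod_eq_zero (Finset.mem_univ i) hi] at h1
        exact lt_irrefl _ h1
      set φ : ℝ → ℝ := fun t => f (Real.exp t) with hφ
      have hφc : ConvexOn ℝ Set.univ φ := hf
      have hφm : Monotone φ := fun s t hst =>
        hm (Real.exp_pos s).le (Real.exp_pos t).le (Real.exp_le_exp.2 hst)
      set D : ℝ → ℝ := fun s => derivWithin φ (Set.Ioi s) s with hD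
      have hDm : Monotone D := by
        have := hφc.monotoneOn_rightDeriv
        simpa [monotoneOn_univ] using this
      have hD0 : ∀ s, 0 ≤ D s := fun s => (hφm.monotoneOn _).derivWithin_nonneg
      have key := Fin.sum_mul_nonneg_of_antitone (fun i => D (Real.log (x i)))
        (fun i => Real.log (p i) - Real.log (x i))
        (fun i j hij => hDm (Real.log_le_log (hxp j) (hx hij))) (fun i => hD0 _)
        (fun k hk => by
          rw [Finset.sum_sub_distrib, sub_nonneg, ← Real.log_prod (fun i _ => (hxp _).ne'),
            ← Real.log_prod (fun i _ => (hpp _).ne')]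
          exact Real.log_le_log (Finset.prod_pos fun i _ => hxp _) (h k hk))
      have h2 : ∀ i, f (x i) + D (Real.log (x i)) * (Real.log (p i) - Real.log (x i)) ≤ f (p i) := by
        intro i
        have := hφc.add_rightDeriv_mul_le (Real.log (x i)) (Real.log (p i))
        simpa only [hφ, Real.exp_log (hxp i), Real.exp_log (hpp i)] using this
      have h3 := Finset.sum_le_sum fun i (_ : i ∈ Finset.univ) => h2 i
      rw [Finset.sum_add_distrib] at h3
      linarith

/-! ### Symmetric norms: pinching and Ky Fan dominance -/

/-- For j ≠ k, flipping the sign at j permutes the sign vectors and negates each summand. -/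
theorem sum_sign_mul_sign {J : Type*} [Fintype J] [DecidableEq J] (j k : J) :
    ∑ ε : J → ℤˣ, (((ε j : ℤ) : ℂ) * ((ε k : ℤ) : ℂ)) =
      if j = k then (Fintype.card (J → ℤˣ) : ℂ) else 0 := by
  split_ifs with h
  · subst h
    rw [Finset.sum_congr rfl (g := fun _ => (1 : ℂ))]
    · simp
    · intro ε _
      rw [← Int.cast_mul, ← Units.val_mul, Int.units_mul_self]; simp
  · have h1 := Equiv.sum_comp (Equiv.mulLeft (Pi.mulSingle j (-1 : ℤˣ)))
      (fun ε : J → ℤˣ => (((ε j : ℤ) : ℂ) * ((ε k : ℤ) : ℂ)))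
    have h2 : (∑ ε : J → ℤˣ, -(((ε j : ℤ) : ℂ) * ((ε k : ℤ) : ℂ))) =
        ∑ ε : J → ℤˣ, (((ε j : ℤ) : ℂ) * ((ε k : ℤ) : ℂ)) := by
      rw [← h1]
      refine Finset.sum_congr rfl fun ε _ => ?_
      simp [Pi.mulSingle_eq_of_ne (Ne.symm h)]
    rw [Finset.sum_neg_distrib] at h2
    exact self_eq_neg.1 h2.symm

theorem Matrix.diagonal_sign_mem_unitaryGroup {ι : Type*} [Fintype ι] [DecidableEq ι]
    (ε : ι → ℤˣ) : Matrix.diagonal (fun i => ((ε i : ℤ) : ℂ)) ∈ Matrix.unitaryGroup ι ℂ := by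
  rw [Matrix.mem_unitaryGroup_iff, Matrix.star_eq_conjTranspose, Matrix.diagonal_conjTranspose,
    Matrix.diagonal_mul_diagonal, ← Matrix.diagonal_one]
  congr 1
  ext i
  rw [Pi.star_apply, RCLike.star_def, map_intCast, ← Int.cast_mul, ← Units.val_mul,
    Int.units_mul_self, Units.val_one, Int.cast_one]

/-- The pinching of a matrix along the fibres of `g`. -/
def Matrix.pinch {ι J : Type*} [DecidableEq J] (g : ι → J) (X : Matrix ι ι ℂ) : Matrix ι ι ℂ :=
  Matrix.of fun a b => if g a = g b then X a b else 0

namespace SymmetricNorm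

variable (N : SymmetricNorm) {ι κ : Type} [Fintype ι] [Fintype κ]

theorem toFun_zero : N.toFun ι 0 = 0 := by
  simpa using N.smul_eq ι 0 0

theorem toFun_neg (X : Matrix ι ι ℂ) : N.toFun ι (-X) = N.toFun ι X := by
  simpa using N.smul_eq ι (-1) X

theorem toFun_nonneg (X : Matrix ι ι ℂ) : 0 ≤ N.toFun ι X := by
  have := N.add_le ι X (-X)
  rw [add_neg_cancel, N.toFun_zero, N.toFun_neg] at this
  linarith

theorem toFun_sum_le {α : Type*} (s : Finset α) (X : α → Matrix ι ι ℂ) :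
    N.toFun ι (∑ i ∈ s, X i) ≤ ∑ i ∈ s, N.toFun ι (X i) :=
  Finset.le_sum_of_subadditive (N.toFun ι) N.toFun_zero.le (N.add_le ι) s X

/-- The pinching is the average of D X D over diagonal sign matrices D that are constant on the
fibres of g. -/
theorem toFun_pinch_le {J : Type*} [Finite J] [DecidableEq J] (g : ι → J) (X : Matrix ι ι ℂ) :
    N.toFun ι (Matrix.pinch g X) ≤ N.toFun ι X := by
  classical
  have := Fintype.ofFinite J
  set D : (J → ℤˣ) → Matrix ι ι ℂ := fun ε => Matrix.diagonal fun i => ((ε (g i) : ℤ) : ℂ) with hD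
  have h1 : ∑ ε, D ε * X * D ε = (Fintype.card (J → ℤˣ) : ℂ) • Matrix.pinch g X := by
    ext a b
    rw [Matrix.sum_apply]
    simp only [hD, Matrix.mul_diagonal, Matrix.diagonal_mul, Matrix.smul_apply, Matrix.pinch,
      Matrix.of_apply, smul_eq_mul]
    rw [Finset.sum_congr rfl fun ε _ => show _ = (((ε (g a) : ℤ) : ℂ) * ((ε (g b) : ℤ) : ℂ)) * X a b
      by ring, ← Finset.sum_mul, sum_sign_mul_sign]
    split_ifs <;> simp
  have h2 := N.toFun_sum_le Finset.univ fun ε => D ε * X * D ε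
  rw [h1, N.smul_eq, Finset.sum_congr rfl fun ε _ => N.unitarily_invariant ι (D ε) (D ε) X
    (Matrix.diagonal_sign_mem_unitaryGroup _) (Matrix.diagonal_sign_mem_unitaryGroup _)] at h2
  rw [Finset.sum_const, Finset.card_univ, nsmul_eq_mul, Complex.norm_natCast] at h2
  exact le_of_mul_le_mul_left h2 (by exact_mod_cast Fintype.card_pos)

/-- Rows and columns of U carry different index types; relabelling the columns along e gives a
genuine unitary. -/
theorem toFun_conj_eq [DecidableEq ι] [DecidableEq κ] (e : κ ≃ ι) (U : Matrix ι κ ℂ)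
    (h1 : U.conjTranspose * U = 1) (X : Matrix κ κ ℂ) :
    N.toFun ι (U * X * U.conjTranspose) = N.toFun κ X := by
  have hW : (U.submatrix id e.symm).conjTranspose * U.submatrix id e.symm = 1 := by
    rw [Matrix.conjTranspose_submatrix, ← Matrix.submatrix_mul _ _ _ _ _ Function.bijective_id, h1,
      Matrix.submatrix_one_equiv]
  have hW1 : U.submatrix id e.symm ∈ Matrix.unitaryGroup ι ℂ := by
    rwa [Matrix.mem_unitaryGroup_iff', Matrix.star_eq_conjTranspose]
  have hW2 : (U.submatrix id e.symm).conjTranspose ∈ Matrix.unitaryGroup ι ℂ := by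
    rw [Matrix.mem_unitaryGroup_iff', Matrix.star_eq_conjTranspose, Matrix.conjTranspose_conjTranspose]
    exact mul_eq_one_comm.1 hW
  rw [← N.reindex_eq κ ι e X, ← N.unitarily_invariant ι _ _ (Matrix.reindex e e X) hW1 hW2]
  congr 1
  rw [Matrix.conjTranspose_submatrix, Matrix.reindex_apply, Matrix.submatrix_mul_equiv,
    Matrix.submatrix_mul_equiv, Matrix.submatrix_id_id]

theorem toFun_diagonal_perm_sign [DecidableEq ι] (σ : Equiv.Perm ι) (ε : ι → ℤˣ) (y : ι → ℝ) :
    N.toFun ι (Matrix.diagonal fun i => (((ε i : ℤ) * y (σ i) : ℝ) : ℂ)) =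
      N.toFun ι (Matrix.diagonal fun i => (y i : ℂ)) := by
  have h1 := N.unitarily_invariant ι (Matrix.diagonal fun i => ((ε i : ℤ) : ℂ)) 1
    (Matrix.reindex σ.symm σ.symm (Matrix.diagonal fun i => (y i : ℂ)))
    (Matrix.diagonal_sign_mem_unitaryGroup _) (one_mem _)
  rw [N.reindex_eq] at h1
  rw [← h1, mul_one]
  congr 1
  simp [Matrix.diagonal_mul_diagonal, Function.comp_def]

theorem convexOn_toFun_diagonal [DecidableEq ι] :
    ConvexOn ℝ Set.univ fun v : ι → ℝ => N.toFun ι (Matrix.diagonal fun i => (v i : ℂ)) := by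
  refine ⟨convex_univ, fun v _ w _ a b ha hb _ => ?_⟩
  have h : (Matrix.diagonal fun i => (((a • v + b • w) i : ℝ) : ℂ)) =
      (a : ℂ) • (Matrix.diagonal fun i => (v i : ℂ)) +
        (b : ℂ) • (Matrix.diagonal fun i => (w i : ℂ)) := by
    ext i j
    by_cases hij : i = j
    · subst hij; simp
    · simp [hij]
  simp only [h, smul_eq_mul]
  refine (N.add_le _ _ _).trans_eq ?_
  rw [N.smul_eq, N.smul_eq, Complex.norm_real, Complex.norm_real, Real.norm_of_nonneg ha,
    Real.norm_of_nonneg hb]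

/-- **Ky Fan dominance** for diagonal matrices. -/
theorem toFun_diagonal_le_of_sum_le {d : ℕ} (x y : Fin d → ℝ) (hx : Antitone x)
    (hx0 : ∀ i, 0 ≤ x i)
    (h : ∀ (k : ℕ) (hk : k ≤ d),
      ∑ i : Fin k, x (Fin.castLE hk i) ≤ ∑ i : Fin k, y (Fin.castLE hk i)) :
    N.toFun (Fin d) (Matrix.diagonal fun i => (x i : ℂ)) ≤
      N.toFun (Fin d) (Matrix.diagonal fun i => (y i : ℂ)) := by
  set F : Equiv.Perm (Fin d) × (Fin d → ℤˣ) → Fin d → ℝ :=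
    fun p i => (p.2 i : ℤ) * y (p.1 i) with hF
  -- The norm is convex and constant on the signed permutations of y, so it suffices that x lies in
  -- their hull. If not, a functional L with coefficients c separates x from them; sorting |c|, the
  -- rearrangement inequality and Abel summation give L x ≤ L at one such point, a contradiction.
  have hmem : x ∈ convexHull ℝ (Set.range F) := by
    by_contra hx'
    obtain ⟨L, u, hL1, hL2⟩ := geometric_hahn_banach_closed_point (convex_convexHull ℝ _)
      ((Set.finite_range F).isClosed_convexHull ℝ) hx'
    set c : Fin d → ℝ := fun i => L (Pi.single i 1) with hc
    have hLc : ∀ v : Fin d → ℝ, L v = ∑ i, v i * c i := fun v => by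
      have := LinearMap.pi_apply_eq_sum_univ (L : (Fin d → ℝ) →ₗ[ℝ] ℝ) v
      simp only [smul_eq_mul, ContinuousLinearMap.coe_coe] at this
      rw [this]
      refine Finset.sum_congr rfl fun i _ => ?_
      rw [hc]; congr 2; ext j; simp [Pi.single_apply, eq_comm]
    set σ := Tuple.sort fun i => -|c i| with hσ
    have hanti : Antitone fun i => |c (σ i)| := fun i j hij => by
      have := Tuple.monotone_sort (fun i => -|c i|) hij
      simpa using this
    have h1 : L x ≤ ∑ i, |c i| * x i := by
      rw [hLc]
      refine Finset.sum_le_sum fun i _ => ?_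
      rw [mul_comm]
      exact mul_le_mul_of_nonneg_right (le_abs_self _) (hx0 i)
    have h2 : ∑ i, |c i| * x i ≤ ∑ i, |c (σ i)| * x i := by
      have := (hanti.monovary hx).sum_comp_perm_mul_le_sum_mul (σ := σ⁻¹)
      simpa using this
    have h3 : ∑ i, |c (σ i)| * x i ≤ ∑ i, |c (σ i)| * y i := by
      have := Fin.sum_mul_nonneg_of_antitone (fun i => |c (σ i)|) (fun i => y i - x i) hanti
        (fun i => abs_nonneg _)
        (fun k hk => by rw [Finset.sum_sub_distrib]; exact sub_nonneg.2 (h k hk))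
      simp only [mul_sub, Finset.sum_sub_distrib] at this
      linarith
    have h4 : ∑ i, |c (σ i)| * y i = L (F (σ⁻¹, fun i => if 0 ≤ c i then 1 else -1)) := by
      rw [hLc, ← Equiv.sum_comp σ⁻¹]
      refine Finset.sum_congr rfl fun i _ => ?_
      simp only [hF]
      split_ifs with hi
      · simp [abs_of_nonneg hi, mul_comm]
      · simp [abs_of_neg (not_le.1 hi), mul_comm]
    have h5 := hL1 _ (subset_convexHull ℝ _ ⟨(σ⁻¹, fun i => if 0 ≤ c i then 1 else -1), rfl⟩)
    linarith
  obtain ⟨_, ⟨p, rfl⟩, hp⟩ := N.convexOn_toFun_diagonal.exists_ge_of_mem_convexHull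
    (Set.subset_univ _) hmem
  refine hp.trans_eq ?_
  exact N.toFun_diagonal_perm_sign p.1 p.2 y

end SymmetricNorm
-- Subadditivity of concave functions on positive semidefinite matrices
open scoped ComplexOrder

/-- Chebyshev's sum inequality for a weighted average over a set of smallest values. -/
theorem Finset.sum_mul_le_sum_mul_sum {κ : Type*} [Fintype κ] [DecidableEq κ] (T : Finset κ)
    (w γ : κ → ℝ) (hw : ∀ j, 0 ≤ w j) (hw1 : ∑ j, w j = 1)
    (hT : ∀ j ∈ T, ∀ i ∉ T, w j ≠ 0 → w i ≠ 0 → γ j ≤ γ i) :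
    ∑ j ∈ T, w j * γ j ≤ (∑ j ∈ T, w j) * ∑ i, w i * γ i := by
  have hc := Finset.sum_add_sum_compl T w
  have hc2 := Finset.sum_add_sum_compl T fun i => w i * γ i
  -- The part of both sides coming from T × T cancels, leaving pairs with one index in T and one
  -- outside.
  have key : (∑ j ∈ T, w j * γ j) * ∑ i ∈ Tᶜ, w i ≤ (∑ j ∈ T, w j) * ∑ i ∈ Tᶜ, w i * γ i := by
    rw [Finset.sum_mul_sum, Finset.sum_mul_sum]
    refine Finset.sum_le_sum fun j hj => Finset.sum_le_sum fun i hi => ?_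
    by_cases h1 : w j = 0
    · simp [h1]
    by_cases h2 : w i = 0
    · simp [h2]
    have := hT j hj i (Finset.mem_compl.1 hi) h1 h2
    have := mul_le_mul_of_nonneg_left this (mul_nonneg (hw j) (hw i))
    nlinarith
  rw [hw1] at hc
  rw [← hc2]
  have : ∑ i ∈ Tᶜ, w i = 1 - ∑ j ∈ T, w j := by linarith
  rw [this] at key
  nlinarith

/-- With H = ∑ w_j/s_j, the weights w_j/(s_j H) average the s_j to 1/H. Jensen bounds the left side
by α H f(1/H), and α ≤ 1/H with f(t)/t nonincreasing finishes. -/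
theorem ConcaveOn.sum_weight_div_le {f : ℝ → ℝ} (hc : ConcaveOn ℝ (Set.Ici 0) f)
    (h0 : ∀ t, 0 ≤ t → 0 ≤ f t) {κ : Type*} [Fintype κ] (w s : κ → ℝ)
    (hw : ∀ j, 0 ≤ w j) (hw1 : ∑ j, w j = 1) (hs : ∀ j, 0 ≤ s j) {α : ℝ} (hα : 0 < α)
    (hws : ∀ j, s j = 0 → w j = 0) (hαs : α * ∑ j, w j / s j ≤ 1) :
    α * ∑ j, w j * (f (s j) / s j) ≤ f α := by
  set H := ∑ j, w j / s j with hH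
  have hterm : ∀ j, 0 ≤ w j / s j := fun j => div_nonneg (hw j) (hs j)
  have hH0 : 0 < H := by
    refine (Finset.sum_nonneg fun j _ => hterm j).lt_of_ne' fun h => ?_
    rw [Finset.sum_eq_zero_iff_of_nonneg fun j _ => hterm j] at h
    have : ∀ j, w j = 0 := fun j => by
      rcases div_eq_zero_iff.1 (h j (Finset.mem_univ j)) with h' | h'
      · exact h'
      · exact hws j h'
    simp [this] at hw1
  have hcancel : ∀ j, w j / s j * s j = w j := fun j => by
    by_cases hj : s j = 0
    · simp [hj, hws j hj]
    · field_simp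
  have hJ := hc.le_map_sum (t := Finset.univ) (w := fun j => w j / s j / H) (p := s)
    (fun j _ => div_nonneg (hterm j) hH0.le)
    (by rw [← Finset.sum_div, div_self hH0.ne']) (fun j _ => hs j)
  have hmean : ∑ j, (w j / s j / H) • s j = 1 / H := by
    rw [← hw1, Finset.sum_div]
    refine Finset.sum_congr rfl fun j _ => ?_
    rw [smul_eq_mul, div_mul_eq_mul_div, hcancel]
  rw [hmean] at hJ
  have hαH : α ≤ 1 / H := by rw [le_div_iff₀ hH0]; exact hαs
  have h2 := hc.div_mul_le_of_nonneg_zero (h0 0 le_rfl) hα.le hαH (by positivity)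
  have h3 : ∑ j, w j * (f (s j) / s j) = H * ∑ j, (w j / s j / H) • f (s j) := by
    rw [Finset.mul_sum]
    refine Finset.sum_congr rfl fun j _ => ?_
    rw [smul_eq_mul]; field_simp
  rw [h3]
  calc α * (H * ∑ j, (w j / s j / H) • f (s j)) ≤ α * (H * f (1 / H)) := by gcongr
    _ = α / (1 / H) * f (1 / H) := by field_simp
    _ ≤ f α := h2

/-- T holds the largest s, hence the smallest f(s)/s, so Chebyshev reduces the partial sum to the
full one. -/
theorem ConcaveOn.sum_weight_div_le_on {f : ℝ → ℝ} (hc : ConcaveOn ℝ (Set.Ici 0) f)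
    (h0 : ∀ t, 0 ≤ t → 0 ≤ f t) {κ : Type*} [Fintype κ] [DecidableEq κ] (T : Finset κ)
    (w s : κ → ℝ) (hw : ∀ j, 0 ≤ w j) (hw1 : ∑ j, w j = 1) (hs : ∀ j, 0 ≤ s j)
    (hT : ∀ j ∈ T, ∀ i ∉ T, s i ≤ s j) {α : ℝ} (hα : 0 ≤ α)
    (hws : ∀ j, s j = 0 → α * w j = 0) (hαs : α * ∑ j, w j / s j ≤ 1) :
    ∑ j ∈ T, α * w j * (f (s j) / s j) ≤ f α * ∑ j ∈ T, w j := by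
  rcases hα.eq_or_lt with rfl | hα'
  · simpa using mul_nonneg (h0 0 le_rfl) (Finset.sum_nonneg fun j _ => hw j)
  have hws' : ∀ j, s j = 0 → w j = 0 := fun j hj =>
    (mul_eq_zero.1 (hws j hj)).resolve_left hα'.ne'
  have h1 := hc.sum_weight_div_le h0 w s hw hw1 hs hα' hws' hαs
  have h2 := Finset.sum_mul_le_sum_mul_sum T w (fun j => f (s j) / s j) hw hw1
    (fun j hj i hi hwj hwi => by
      have hsi : 0 < s i := (hs i).lt_of_ne' fun h => hwi (hws' i h)
      have hij := hT j hj i hi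
      have hsj := hsi.trans_le hij
      have := hc.div_mul_le_of_nonneg_zero (h0 0 le_rfl) hsi.le hij hsj
      rw [div_le_div_iff₀ hsj hsi]
      rw [div_mul_eq_mul_div, div_le_iff₀ hsj] at this
      linarith)
  have hW : 0 ≤ ∑ j ∈ T, w j := Finset.sum_nonneg fun j _ => hw j
  calc ∑ j ∈ T, α * w j * (f (s j) / s j) = α * ∑ j ∈ T, w j * (f (s j) / s j) := by
        rw [Finset.mul_sum]; exact Finset.sum_congr rfl fun j _ => by ring
    _ ≤ α * ((∑ j ∈ T, w j) * ∑ i, w i * (f (s i) / s i)) := by gcongr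
    _ = (∑ j ∈ T, w j) * (α * ∑ i, w i * (f (s i) / s i)) := by ring
    _ ≤ (∑ j ∈ T, w j) * f α := by gcongr
    _ = _ := mul_comm _ _

namespace Matrix

theorem conjTranspose_mul_diagonal_mul_apply {ι κ : Type*} [Fintype ι] [DecidableEq ι]
    (W : Matrix ι κ ℂ) (g : ι → ℝ) (j : κ) :
    (W.conjTranspose * diagonal (fun i => (g i : ℂ)) * W) j j =
      ((∑ i, g i * ‖W i j‖ ^ 2 : ℝ) : ℂ) := by
  rw [mul_apply]
  push_cast
  refine Finset.sum_congr rfl fun i _ => ?_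
  rw [mul_diagonal, conjTranspose_apply, ← Complex.conj_mul', RCLike.star_def]
  ring

theorem dotProduct_diagonal_mulVec {ι : Type*} [Fintype ι] [DecidableEq ι] (g : ι → ℝ) (x : ι → ℂ) :
    star x ⬝ᵥ (diagonal (fun i => (g i : ℂ)) *ᵥ x) = ((∑ i, g i * ‖x i‖ ^ 2 : ℝ) : ℂ) := by
  simp only [dotProduct, mulVec_diagonal, Pi.star_apply, RCLike.star_def]
  push_cast
  refine Finset.sum_congr rfl fun i _ => ?_
  rw [← Complex.conj_mul']
  ring

theorem dotProduct_conjTranspose_mul_mul_mulVec {ι κ : Type*} [Fintype ι] [Fintype κ]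
    (W : Matrix ι κ ℂ) (D : Matrix ι ι ℂ)
    (x : κ → ℂ) :
    star x ⬝ᵥ ((W.conjTranspose * D * W) *ᵥ x) = star (W *ᵥ x) ⬝ᵥ (D *ᵥ (W *ᵥ x)) := by
  rw [star_mulVec, ← mulVec_mulVec, ← mulVec_mulVec, dotProduct_mulVec]

theorem sum_normSq_eq_one {ι κ : Type*} [Fintype κ] [DecidableEq ι]
    {W : Matrix ι κ ℂ} (h : W * W.conjTranspose = 1) (i : ι) :
    ∑ j, ‖W i j‖ ^ 2 = 1 := by
  have := congr_fun₂ h i i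
  rw [mul_apply, one_apply_eq] at this
  have h2 : ((∑ j, ‖W i j‖ ^ 2 : ℝ) : ℂ) = 1 := by
    rw [← this]; push_cast
    refine Finset.sum_congr rfl fun j _ => ?_
    rw [← Complex.mul_conj', conjTranspose_apply, RCLike.star_def]
  exact_mod_cast h2

/-- Testing W* diag(α) W ≤ diag(s) on x = diag(s)⁻¹ W* e_i gives α_i H² ≤ H, where H is the sum in
question. Where s_j = 0, division by zero sets x_j = 0. -/
theorem eigen_mul_sum_div_le_one {ι κ : Type*} [Fintype ι] [Fintype κ] [DecidableEq ι]
    [DecidableEq κ] {W : Matrix ι κ ℂ} {α : ι → ℝ} {s : κ → ℝ}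
    (hα : ∀ i, 0 ≤ α i) (hs : ∀ j, 0 ≤ s j)
    (h : (diagonal (fun j => (s j : ℂ)) -
      W.conjTranspose * diagonal (fun i => (α i : ℂ)) * W).PosSemidef) (i : ι) :
    α i * ∑ j, ‖W i j‖ ^ 2 / s j ≤ 1 := by
  set H := ∑ j, ‖W i j‖ ^ 2 / s j with hH
  have hH0 : 0 ≤ H := Finset.sum_nonneg fun j _ => div_nonneg (sq_nonneg _) (hs j)
  rcases hH0.eq_or_lt with h0 | h0
  · rw [← h0]; simp
  set x : κ → ℂ := fun j => star (W i j) / (s j : ℂ) with hx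
  have h1 := h.dotProduct_mulVec_nonneg x
  rw [sub_mulVec, dotProduct_sub, dotProduct_conjTranspose_mul_mul_mulVec,
    dotProduct_diagonal_mulVec, dotProduct_diagonal_mulVec, ← Complex.ofReal_sub,
    Complex.zero_le_real, sub_nonneg] at h1
  have h2 : ∑ j, s j * ‖x j‖ ^ 2 = H := by
    refine Finset.sum_congr rfl fun j _ => ?_
    rw [hx]
    simp only [norm_div, norm_star, Complex.norm_real, Real.norm_of_nonneg (hs j)]
    by_cases hj : s j = 0
    · simp [hj]
    · field_simp
  have h3 : (W *ᵥ x) i = (H : ℂ) := by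
    simp only [mulVec, dotProduct, hx, hH]
    push_cast
    refine Finset.sum_congr rfl fun j _ => ?_
    rw [← Complex.mul_conj', RCLike.star_def]; ring
  have h4 : α i * ‖(W *ᵥ x) i‖ ^ 2 ≤ ∑ i, α i * ‖(W *ᵥ x) i‖ ^ 2 :=
    Finset.single_le_sum (f := fun i => α i * ‖(W *ᵥ x) i‖ ^ 2)
      (fun i _ => mul_nonneg (hα i) (sq_nonneg _)) (Finset.mem_univ i)
  rw [h3, Complex.norm_real, Real.norm_of_nonneg hH0] at h4
  nlinarith

theorem eigen_mul_normSq_eq_zero {ι κ : Type*} [Fintype ι] [DecidableEq ι] [DecidableEq κ]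
    {W : Matrix ι κ ℂ} {α : ι → ℝ} {s : κ → ℝ} (hα : ∀ i, 0 ≤ α i)
    (h : (diagonal (fun j => (s j : ℂ)) -
      W.conjTranspose * diagonal (fun i => (α i : ℂ)) * W).PosSemidef) (i : ι) {j : κ}
    (hj : s j = 0) : α i * ‖W i j‖ ^ 2 = 0 := by
  have h1 := h.diag_nonneg (i := j)
  rw [sub_apply, diagonal_apply_eq, conjTranspose_mul_diagonal_mul_apply, ← Complex.ofReal_sub,
    Complex.zero_le_real, hj, sub_nonneg] at h1
  have h2 : ∀ i, 0 ≤ α i * ‖W i j‖ ^ 2 := fun i => mul_nonneg (hα i) (sq_nonneg _)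
  have h3 := le_antisymm h1 (Finset.sum_nonneg fun i _ => h2 i)
  exact (Finset.sum_eq_zero_iff_of_nonneg fun i _ => h2 i).1 h3 i (Finset.mem_univ i)

end Matrix

theorem exists_antitone_comp_equiv {ι : Type*} [Fintype ι] (g : ι → ℝ) :
    ∃ e : Fin (Fintype.card ι) ≃ ι, Antitone (g ∘ e) := by
  let e := (Fintype.equivFin ι).symm
  refine ⟨(Tuple.sort fun i => -g (e i)).trans e, fun i j hij => ?_⟩
  have := Tuple.monotone_sort (fun i => -g (e i)) hij
  simpa using this

namespace Matrix

/-- One U serves every f. Columns are indexed by `Fin` so that "the first k eigenvectors" makes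
sense, and g fixes the order: absolute value for A, the identity for positive semidefinite matrices.
-/
theorem IsHermitian.exists_diagonalization {ι : Type*} [Fintype ι] [DecidableEq ι]
    {A : Matrix ι ι ℂ} (hA : A.IsHermitian) (g : ℝ → ℝ) :
    ∃ (U : Matrix ι (Fin (Fintype.card ι)) ℂ) (a : Fin (Fintype.card ι) → ℝ),
      U.conjTranspose * U = 1 ∧ U * U.conjTranspose = 1 ∧ Antitone (fun i => g (a i)) ∧
      A = U * diagonal (fun i => (a i : ℂ)) * U.conjTranspose ∧
      ∀ f : ℝ → ℝ, cfc f A = U * diagonal (fun i => (f (a i) : ℂ)) * U.conjTranspose := by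
  obtain ⟨e, he⟩ := exists_antitone_comp_equiv fun i => g (hA.eigenvalues i)
  have hU1 : (hA.eigenvectorUnitary : Matrix ι ι ℂ).conjTranspose * hA.eigenvectorUnitary = 1 :=
    Unitary.star_mul_self_of_mem hA.eigenvectorUnitary.2
  have hU2 : (hA.eigenvectorUnitary : Matrix ι ι ℂ) *
      (hA.eigenvectorUnitary : Matrix ι ι ℂ).conjTranspose = 1 :=
    Unitary.mul_star_self_of_mem hA.eigenvectorUnitary.2
  have key : ∀ f : ℝ → ℝ, (hA.eigenvectorUnitary : Matrix ι ι ℂ) *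
      diagonal (fun i => (f (hA.eigenvalues i) : ℂ)) *
        (hA.eigenvectorUnitary : Matrix ι ι ℂ).conjTranspose =
      (hA.eigenvectorUnitary : Matrix ι ι ℂ).submatrix id e *
      diagonal (fun i => (f (hA.eigenvalues (e i)) : ℂ)) *
        ((hA.eigenvectorUnitary : Matrix ι ι ℂ).submatrix id e).conjTranspose := by
    intro f
    have hd : diagonal (fun i => (f (hA.eigenvalues (e i)) : ℂ)) =
        (diagonal (fun i => (f (hA.eigenvalues i) : ℂ))).submatrix e e := by
      rw [submatrix_diagonal_equiv]; rfl
    rw [hd, conjTranspose_submatrix, submatrix_mul_equiv, submatrix_mul_equiv, submatrix_id_id]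
  refine ⟨(hA.eigenvectorUnitary : Matrix ι ι ℂ).submatrix id e, fun i => hA.eigenvalues (e i),
    ?_, ?_, he, ?_, fun f => ?_⟩
  · rw [conjTranspose_submatrix, ← submatrix_mul _ _ _ _ _ Function.bijective_id, hU1,
      submatrix_one_equiv]
  · rw [conjTranspose_submatrix, submatrix_mul_equiv, hU2, submatrix_id_id]
  · refine Eq.trans ?_ (key id)
    conv_lhs => rw [hA.spectral_theorem]
    rfl
  · rw [hA.cfc_eq f]
    exact key f

theorem IsHermitian.exists_antitone_abs_diagonalization {ι : Type} [Fintype ι] [DecidableEq ι]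
    {A : Matrix ι ι ℂ} (hA : A.IsHermitian) :
    ∃ (U : Matrix ι (Fin (Fintype.card ι)) ℂ) (a : Fin (Fintype.card ι) → ℝ),
      U.conjTranspose * U = 1 ∧ U * U.conjTranspose = 1 ∧ Antitone (fun i => |a i|) ∧
      A = U * diagonal (fun i => (a i : ℂ)) * U.conjTranspose ∧
      ∀ f : ℝ → ℝ, funAbs f A = U * diagonal (fun i => (f |a i| : ℂ)) * U.conjTranspose := by
  obtain ⟨U, a, h1, h2, h3, h4, h5⟩ := hA.exists_diagonalization fun t => |t|
  refine ⟨U, a, h1, h2, h3, h4, fun f => ?_⟩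
  rw [← h5 (fun t => f |t|), funAbs, CFC.abs_eq_cfc_norm A hA.isSelfAdjoint,
    ← cfc_comp' f (fun x : ℝ => ‖x‖) A
      ((finite_real_spectrum.image _).continuousOn f) (by fun_prop) hA.isSelfAdjoint]
  rfl

theorem PosSemidef.exists_antitone_diagonalization {ι : Type*} [Fintype ι] [DecidableEq ι]
    {P : Matrix ι ι ℂ} (hP : P.PosSemidef) :
    ∃ (U : Matrix ι (Fin (Fintype.card ι)) ℂ) (p : Fin (Fintype.card ι) → ℝ),
      U.conjTranspose * U = 1 ∧ U * U.conjTranspose = 1 ∧ Antitone p ∧ (∀ i, 0 ≤ p i) ∧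
      P = U * diagonal (fun i => (p i : ℂ)) * U.conjTranspose ∧
      ∀ f : ℝ → ℝ, cfc f P = U * diagonal (fun i => (f (p i) : ℂ)) * U.conjTranspose := by
  obtain ⟨U, a, h1, h2, h3, h4, h5⟩ := hP.isHermitian.exists_diagonalization id
  refine ⟨U, a, h1, h2, h3, fun i => ?_, h4, h5⟩
  have h6 := hP.conjTranspose_mul_mul_same U
  have h7 : U.conjTranspose * P * U = diagonal (fun i => (a i : ℂ)) := by
    rw [h4]
    simp only [← Matrix.mul_assoc, h1, Matrix.one_mul]
    rw [Matrix.mul_assoc, h1, Matrix.mul_one]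
  rw [h7] at h6
  have := h6.diag_nonneg (i := i)
  rw [diagonal_apply_eq] at this
  exact Complex.zero_le_real.1 this

/-- One summand of the subadditivity inequality, in an eigenbasis `U` of a majorant. -/
theorem sum_div_mul_le_of_le {ι κ : Type*} [Fintype ι] [DecidableEq ι] [Fintype κ] [DecidableEq κ]
    {f : ℝ → ℝ} (hc : ConcaveOn ℝ (Set.Ici 0) f) (h0 : ∀ t, 0 ≤ t → 0 ≤ f t)
    {Q : Matrix ι ι ℂ} (hQ : Q.PosSemidef) (U : Matrix ι κ ℂ) (hU : U * U.conjTranspose = 1)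
    (s : κ → ℝ) (hs : ∀ j, 0 ≤ s j)
    (hle : (diagonal (fun j => (s j : ℂ)) - U.conjTranspose * Q * U).PosSemidef)
    (T : Finset κ) (hT : ∀ j ∈ T, ∀ i ∉ T, s i ≤ s j) :
    ∑ j ∈ T, ((U.conjTranspose * Q * U) j j).re * (f (s j) / s j) ≤
      ∑ j ∈ T, ((U.conjTranspose * cfc f Q * U) j j).re := by
  obtain ⟨V, α, hV1, hV2, -, hα, hQV, hf⟩ := hQ.exists_antitone_diagonalization
  set W := V.conjTranspose * U with hW
  have hconj : ∀ D : Matrix (Fin (Fintype.card ι)) (Fin (Fintype.card ι)) ℂ,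
      U.conjTranspose * (V * D * V.conjTranspose) * U = W.conjTranspose * D * W := by
    intro D
    rw [hW, conjTranspose_mul, conjTranspose_conjTranspose]
    simp only [Matrix.mul_assoc]
  have hWW : W * W.conjTranspose = 1 := by
    rw [hW, conjTranspose_mul, conjTranspose_conjTranspose, Matrix.mul_assoc, ← Matrix.mul_assoc U,
      hU, Matrix.one_mul, hV1]
  have hQW : U.conjTranspose * Q * U = W.conjTranspose * diagonal (fun i => (α i : ℂ)) * W := by
    rw [← hconj, ← hQV]
  rw [hf f, hconj, hQW]
  rw [hQW] at hle
  simp only [conjTranspose_mul_diagonal_mul_apply, Complex.ofReal_re]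
  -- For each eigenvector of Q, row i of |W|² is a probability vector, so the scalar inequality
  -- applies one eigenvalue at a time.
  have key : ∀ i, ∑ j ∈ T, α i * ‖W i j‖ ^ 2 * (f (s j) / s j) ≤
      f (α i) * ∑ j ∈ T, ‖W i j‖ ^ 2 := fun i =>
    hc.sum_weight_div_le_on h0 T (fun j => ‖W i j‖ ^ 2) s (fun j => sq_nonneg _)
      (sum_normSq_eq_one hWW i) hs hT (hα i)
      (fun j hj => eigen_mul_normSq_eq_zero hα hle i hj) (eigen_mul_sum_div_le_one hα hs hle i)
  calc ∑ j ∈ T, (∑ i, α i * ‖W i j‖ ^ 2) * (f (s j) / s j)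
      = ∑ i, ∑ j ∈ T, α i * ‖W i j‖ ^ 2 * (f (s j) / s j) := by
        rw [Finset.sum_comm]; simp only [Finset.sum_mul]
    _ ≤ ∑ i, f (α i) * ∑ j ∈ T, ‖W i j‖ ^ 2 := Finset.sum_le_sum fun i _ => key i
    _ = _ := by rw [Finset.sum_comm]; simp only [Finset.mul_sum]

/-- Write f(s_j) = s_j · f(s_j)/s_j and split s_j into the diagonal entries of the U* `Q l` U; each
`Q l` is below the sum. At s_j = 0 the quotient is 0, which is harmless because f(0) = 0. -/
theorem sum_concave_eigenvalues_le_aux {ι κ L : Type*} [Fintype ι] [DecidableEq ι] [Fintype κ]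
    [DecidableEq κ] [Fintype L] {f : ℝ → ℝ} (hc : ConcaveOn ℝ (Set.Ici 0) f)
    (h0 : ∀ t, 0 ≤ t → 0 ≤ f t) (hf0 : f 0 = 0) (Q : L → Matrix ι ι ℂ)
    (hQ : ∀ l, (Q l).PosSemidef) (U : Matrix ι κ ℂ) (hU : U * U.conjTranspose = 1)
    (s : κ → ℝ) (hs : ∀ j, 0 ≤ s j)
    (hS : U.conjTranspose * (∑ l, Q l) * U = diagonal (fun j => (s j : ℂ)))
    (T : Finset κ) (hT : ∀ j ∈ T, ∀ i ∉ T, s i ≤ s j) :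
    ∑ j ∈ T, f (s j) ≤ ∑ j ∈ T, ((U.conjTranspose * (∑ l, cfc f (Q l)) * U) j j).re := by
  classical
  have hexp : ∀ (G : L → Matrix ι ι ℂ) (j : κ), ((U.conjTranspose * (∑ l, G l) * U) j j).re =
      ∑ l, ((U.conjTranspose * G l * U) j j).re := by
    intro G j
    rw [Matrix.mul_sum, Matrix.sum_mul, sum_apply, Complex.re_sum]
  have hle : ∀ l, (diagonal (fun j => (s j : ℂ)) - U.conjTranspose * Q l * U).PosSemidef := by
    intro l
    rw [← hS, ← Matrix.sub_mul, ← Matrix.mul_sub]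
    refine PosSemidef.conjTranspose_mul_mul_same ?_ U
    rw [← Finset.add_sum_erase _ _ (Finset.mem_univ l), add_sub_cancel_left]
    exact posSemidef_sum _ fun i _ => hQ i
  calc ∑ j ∈ T, f (s j)
      = ∑ j ∈ T, ∑ l, ((U.conjTranspose * Q l * U) j j).re * (f (s j) / s j) := by
        refine Finset.sum_congr rfl fun j _ => ?_
        rw [← Finset.sum_mul, ← hexp, hS, diagonal_apply_eq, Complex.ofReal_re]
        by_cases hj : s j = 0
        · simp [hj, hf0]
        · field_simp
    _ ≤ ∑ l, ∑ j ∈ T, ((U.conjTranspose * cfc f (Q l) * U) j j).re := by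
        rw [Finset.sum_comm]
        exact Finset.sum_le_sum fun l _ => sum_div_mul_le_of_le hc h0 (hQ l) U hU s hs (hle l) T hT
    _ = _ := by rw [Finset.sum_comm]; simp only [hexp]

/-- Subadditivity of a nonnegative concave function on positive semidefinite matrices, tested on a
set of top eigenvectors of the sum. -/
theorem sum_concave_eigenvalues_le {ι κ L : Type*} [Fintype ι] [DecidableEq ι] [Fintype κ]
    [DecidableEq κ] [Fintype L] [Nonempty L] {f : ℝ → ℝ} (hc : ConcaveOn ℝ (Set.Ici 0) f)
    (h0 : ∀ t, 0 ≤ t → 0 ≤ f t) (Q : L → Matrix ι ι ℂ)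
    (hQ : ∀ l, (Q l).PosSemidef) (U : Matrix ι κ ℂ) (hU' : U.conjTranspose * U = 1)
    (hU : U * U.conjTranspose = 1) (s : κ → ℝ) (hs : ∀ j, 0 ≤ s j)
    (hS : U.conjTranspose * (∑ l, Q l) * U = diagonal (fun j => (s j : ℂ)))
    (T : Finset κ) (hT : ∀ j ∈ T, ∀ i ∉ T, s i ≤ s j) :
    ∑ j ∈ T, f (s j) ≤ ∑ j ∈ T, ((U.conjTranspose * (∑ l, cfc f (Q l)) * U) j j).re := by
  have hm := hc.monotoneOn_Ici_of_nonneg h0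
  -- Apply the case f(0) = 0 to f - f(0). Restoring the constant adds f(0) per index of T on the
  -- left and at least as much on the right, L being nonempty.
  have key := sum_concave_eigenvalues_le_aux (f := fun t => f t - f 0)
    (hc.sub (convexOn_const (f 0) (convex_Ici 0)))
    (fun t ht => sub_nonneg.2 (hm (Set.mem_Ici.2 le_rfl) ht ht)) (sub_self _) Q hQ U hU s hs hS T hT
  have hcfc : ∀ l, cfc (fun t => f t - f 0) (Q l) = cfc f (Q l) - (f 0 : ℂ) • 1 := by
    intro l
    obtain ⟨V, α, hV1, hV2, -, hα, hQV, hf⟩ := (hQ l).exists_antitone_diagonalization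
    rw [hf, hf]
    have : diagonal (fun i => ((f (α i) - f 0 : ℝ) : ℂ)) =
        diagonal (fun i => (f (α i) : ℂ)) - (f 0 : ℂ) • 1 := by
      ext i j
      by_cases hij : i = j
      · subst hij; simp
      · simp [hij]
    rw [this, Matrix.mul_sub, Matrix.sub_mul, Matrix.mul_smul, Matrix.mul_one, Matrix.smul_mul, hV2]
  have hsum : ∀ j, ((U.conjTranspose * (∑ l, cfc (fun t => f t - f 0) (Q l)) * U) j j).re =
      ((U.conjTranspose * (∑ l, cfc f (Q l)) * U) j j).re - Fintype.card L * f 0 := by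
    intro j
    simp only [hcfc, Finset.sum_sub_distrib, Finset.sum_const, Finset.card_univ]
    rw [Matrix.mul_sub, Matrix.sub_mul, sub_apply, Complex.sub_re, ← Nat.cast_smul_eq_nsmul ℂ,
      smul_smul, Matrix.mul_smul, Matrix.mul_one, Matrix.smul_mul, hU', smul_apply, one_apply_eq,
      smul_eq_mul, mul_one, ← Complex.ofReal_natCast, ← Complex.ofReal_mul, Complex.ofReal_re]
  simp only [hsum, Finset.sum_sub_distrib, Finset.sum_const, nsmul_eq_mul] at key
  have h1 : (1 : ℝ) ≤ Fintype.card L := by exact_mod_cast Fintype.card_pos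
  have h2 : (T.card : ℝ) * f 0 ≤ T.card * (Fintype.card L * f 0) :=
    mul_le_mul_of_nonneg_left (le_mul_of_one_le_left (h0 0 le_rfl) h1) (Nat.cast_nonneg _)
  linarith

end Matrix

/-! ### Weak log-majorization from -P ≤ A ≤ P -/

namespace Matrix

theorem dotProduct_star_self_eq_sum {ι : Type*} [Fintype ι] (x : ι → ℂ) :
    star x ⬝ᵥ x = ((∑ i, ‖x i‖ ^ 2 : ℝ) : ℂ) := by
  classical
  simpa using dotProduct_diagonal_mulVec (fun _ => (1 : ℝ)) x

/-- **Cauchy interlacing** for compressions of diagonal matrices (one-sided). -/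
theorem compression_eigenvalue_le {d k : ℕ} (hk : k ≤ d) (Z : Matrix (Fin d) (Fin k) ℂ)
    (hZ : Z.conjTranspose * Z = 1) (p : Fin d → ℝ) (μ : Fin k → ℝ) (hp : Antitone p)
    (hμ : Antitone μ) (h : Z.conjTranspose * diagonal (fun i => (p i : ℂ)) * Z =
      diagonal (fun i => (μ i : ℂ))) (r : Fin k) : μ r ≤ p (Fin.castLE hk r) := by
  have hr := r.2
  let ψ : Fin (r + 1) → Fin k := Fin.castLE hr
  let θ : Fin r → Fin d := Fin.castLE (hr.le.trans hk)
  -- With r equations in r + 1 unknowns there is a nonzero x supported on coordinates 0, …, r with Z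
  -- x vanishing on coordinates below r. Its quadratic form lies between μ_r‖x‖² and p_r‖x‖².
  have hker := LinearMap.ker_ne_bot_of_finrank_lt (f := (Z.submatrix θ ψ).mulVecLin) (by simp)
  obtain ⟨c, hc, hc0⟩ := (Submodule.ne_bot_iff _).1 hker
  let x : Fin k → ℂ := fun j => if hj : (j : ℕ) < r + 1 then c ⟨j, hj⟩ else 0
  have hxψ : ∀ j, x (ψ j) = c j := fun j =>
    dif_pos (show ((ψ j : Fin k) : ℕ) < r + 1 from j.2)
  have hx0 : ∀ j, r < j → x j = 0 := fun j hj =>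
    dif_neg (by have : (r : ℕ) < j := hj; omega)
  have hZx : ∀ l : Fin d, (l : ℕ) < r → (Z *ᵥ x) l = 0 := by
    intro l hl
    have h1 : (Z.submatrix θ ψ).mulVec c ⟨l, hl⟩ = 0 := by
      have : (Z.submatrix θ ψ).mulVec c = 0 := hc
      rw [this]; rfl
    rw [← h1]
    simp only [mulVec, dotProduct, submatrix_apply]
    have hψ : Function.Injective ψ := Fin.castLE_injective _
    refine (Fintype.sum_of_injective ψ hψ _ _ (fun j hj => ?_) (fun j => ?_)).symm
    · rw [show x j = 0 from ?_, mul_zero]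
      refine dif_neg fun hjr => hj ⟨⟨j, hjr⟩, rfl⟩
    · rw [hxψ]; rfl
  have hxne : 0 < ∑ j, ‖x j‖ ^ 2 := by
    obtain ⟨j, hj⟩ := Function.ne_iff.1 hc0
    refine Finset.sum_pos' (fun j _ => sq_nonneg _) ⟨ψ j, Finset.mem_univ _, ?_⟩
    rw [hxψ]
    exact pow_pos (norm_pos_iff.2 hj) 2
  have hnorm : ∑ l, ‖(Z *ᵥ x) l‖ ^ 2 = ∑ j, ‖x j‖ ^ 2 := by
    have h1 := dotProduct_conjTranspose_mul_mul_mulVec Z 1 x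
    rw [Matrix.mul_one, hZ, one_mulVec, one_mulVec, dotProduct_star_self_eq_sum,
      dotProduct_star_self_eq_sum] at h1
    exact_mod_cast h1.symm
  have hquad : ∑ j, μ j * ‖x j‖ ^ 2 = ∑ l, p l * ‖(Z *ᵥ x) l‖ ^ 2 := by
    have h1 := dotProduct_conjTranspose_mul_mul_mulVec Z (diagonal fun i => (p i : ℂ)) x
    rw [h, dotProduct_diagonal_mulVec, dotProduct_diagonal_mulVec] at h1
    exact_mod_cast h1
  have h1 : μ r * ∑ j, ‖x j‖ ^ 2 ≤ ∑ j, μ j * ‖x j‖ ^ 2 := by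
    rw [Finset.mul_sum]
    refine Finset.sum_le_sum fun j _ => ?_
    rcases le_or_gt j r with hj | hj
    · exact mul_le_mul_of_nonneg_right (hμ hj) (sq_nonneg _)
    · simp [hx0 j hj]
  have h2 : ∑ l, p l * ‖(Z *ᵥ x) l‖ ^ 2 ≤ p (Fin.castLE hk r) * ∑ l, ‖(Z *ᵥ x) l‖ ^ 2 := by
    rw [Finset.mul_sum]
    refine Finset.sum_le_sum fun l _ => ?_
    rcases lt_or_ge (l : ℕ) r with hl | hl
    · simp [hZx l hl]
    · exact mul_le_mul_of_nonneg_right (hp (show Fin.castLE hk r ≤ l from hl)) (sq_nonneg _)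
  rw [hnorm] at h2
  exact le_of_mul_le_mul_right (h1.trans (hquad.le.trans h2)) hxne

theorem norm_det_le_one_of_le_one {k : Type*} [Fintype k] [DecidableEq k] {K : Matrix k k ℂ}
    (hK : K.IsHermitian) (h1 : (1 - K).PosSemidef) (h2 : (1 + K).PosSemidef) : ‖K.det‖ ≤ 1 := by
  rw [hK.det_eq_prod_eigenvalues, norm_prod]
  refine Finset.prod_le_one (fun _ _ => norm_nonneg _) fun i _ => ?_
  have hv : star ⇑(hK.eigenvectorBasis i) ⬝ᵥ ⇑(hK.eigenvectorBasis i) = 1 := by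
    have := hK.eigenvectorBasis.orthonormal.1 i
    rw [dotProduct_star_self_eq_sum, ← EuclideanSpace.norm_sq_eq, this]; simp
  have e : K *ᵥ ⇑(hK.eigenvectorBasis i) =
    (hK.eigenvalues i : ℂ) • ⇑(hK.eigenvectorBasis i) := hK.mulVec_eigenvectorBasis i
  have q1 := h1.dotProduct_mulVec_nonneg ⇑(hK.eigenvectorBasis i)
  have q2 := h2.dotProduct_mulVec_nonneg ⇑(hK.eigenvectorBasis i)
  rw [sub_mulVec, one_mulVec, e, dotProduct_sub, dotProduct_smul, hv, smul_eq_mul, mul_one,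
    ← Complex.ofReal_one, ← Complex.ofReal_sub, Complex.zero_le_real] at q1
  rw [add_mulVec, one_mulVec, e, dotProduct_add, dotProduct_smul, hv, smul_eq_mul, mul_one,
    ← Complex.ofReal_one, ← Complex.ofReal_add, Complex.zero_le_real] at q2
  rw [RCLike.norm_ofReal, abs_le]
  constructor <;> linarith

/-- If P = B*B is invertible, then A = B*KB with -1 ≤ K ≤ 1, so |det K| ≤ 1. If P is singular, A
kills each kernel vector of P, and both determinants vanish. -/
theorem norm_det_le_det_of_le {k : Type*} [Fintype k] [DecidableEq k] {A P : Matrix k k ℂ}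
    (hA : A.IsHermitian) (h1 : (P - A).PosSemidef) (h2 : (P + A).PosSemidef) :
    ‖A.det‖ ≤ ‖P.det‖ := by
  have hP : P.PosSemidef := by
    have h3 := (h1.add h2).smul (show (0 : ℝ) ≤ 1 / 2 by norm_num)
    convert h3 using 1
    rw [sub_add_add_cancel, ← two_smul ℝ, smul_smul]; norm_num
  by_cases hd : P.det = 0
  · obtain ⟨x, hx, hPx⟩ := exists_mulVec_eq_zero_iff.2 hd
    have q1 := h1.dotProduct_mulVec_nonneg x
    have q2 := h2.dotProduct_mulVec_nonneg x
    rw [sub_mulVec, hPx, zero_sub, dotProduct_neg, neg_nonneg] at q1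
    rw [add_mulVec, hPx, zero_add] at q2
    have q3 := (h2.dotProduct_mulVec_zero_iff x).1
      (by rw [add_mulVec, hPx, zero_add]; exact le_antisymm q1 q2)
    rw [add_mulVec, hPx, zero_add] at q3
    rw [exists_mulVec_eq_zero_iff.1 ⟨x, hx, q3⟩, hd]
  · obtain ⟨B, rfl⟩ : ∃ B, P = B.conjTranspose * B :=
      CStarAlgebra.nonneg_iff_eq_star_mul_self.1 hP.nonneg
    have hB : IsUnit B.det := by
      rw [isUnit_iff_ne_zero]; intro h; simp [h] at hd
    have hB' : B⁻¹.conjTranspose * B.conjTranspose = 1 := by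
      rw [← conjTranspose_mul, mul_nonsing_inv _ hB, conjTranspose_one]
    have hone : B⁻¹.conjTranspose * (B.conjTranspose * B) * B⁻¹ = 1 := by
      rw [← Matrix.mul_assoc, hB', Matrix.one_mul, mul_nonsing_inv _ hB]
    set K := B⁻¹.conjTranspose * A * B⁻¹ with hK
    have hAK : A = B.conjTranspose * K * B := by
      have hB'' : B.conjTranspose * B⁻¹.conjTranspose = 1 := by
        rw [← conjTranspose_mul, nonsing_inv_mul _ hB, conjTranspose_one]
      rw [hK]
      simp only [← Matrix.mul_assoc]
      rw [hB'', Matrix.one_mul, Matrix.mul_assoc, nonsing_inv_mul _ hB, Matrix.mul_one]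
    have k1 := h1.conjTranspose_mul_mul_same B⁻¹
    have k2 := h2.conjTranspose_mul_mul_same B⁻¹
    rw [Matrix.mul_sub, Matrix.sub_mul, hone] at k1
    rw [Matrix.mul_add, Matrix.add_mul, hone] at k2
    have k3 := norm_det_le_one_of_le_one (isHermitian_conjTranspose_mul_mul B⁻¹ hA) k1 k2
    rw [← hK] at k3
    clear_value K
    rw [hAK, det_mul, det_mul, det_mul, norm_mul, norm_mul, norm_mul]
    have := mul_le_mul_of_nonneg_left k3 (mul_nonneg (norm_nonneg B.conjTranspose.det)
      (norm_nonneg B.det))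
    nlinarith

/-- If `-P ≤ A ≤ P` then the eigenvalues of `|A|` are weakly log-majorized by those of `P`. -/
theorem prod_abs_le_prod_of_le {ι : Type*} [Fintype ι] [DecidableEq ι] {d : ℕ}
    {A P : Matrix ι ι ℂ} (hA : A.IsHermitian) (h1 : (P - A).PosSemidef) (h2 : (P + A).PosSemidef)
    (hP : P.PosSemidef) (U V : Matrix ι (Fin d) ℂ) (a p : Fin d → ℝ)
    (hV : V.conjTranspose * V = 1) (hU2 : U * U.conjTranspose = 1)
    (hAV : V.conjTranspose * A * V = diagonal (fun i => (a i : ℂ)))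
    (hPU : P = U * diagonal (fun i => (p i : ℂ)) * U.conjTranspose) (hp : Antitone p)
    (k : ℕ) (hk : k ≤ d) :
    ∏ i : Fin k, |a (Fin.castLE hk i)| ≤ ∏ i : Fin k, p (Fin.castLE hk i) := by
  -- Compress to the first k eigenvectors of A. The determinant of W*AW is the product of the a_i;
  -- that of W*PW is a product of eigenvalues, each bounded by interlacing.
  set W : Matrix ι (Fin k) ℂ := V.submatrix id (Fin.castLE hk) with hW
  have hinj : Function.Injective (Fin.castLE hk) := Fin.castLE_injective hk
  have hWsub : ∀ D : Matrix ι ι ℂ, W.conjTranspose * D * W =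
      (V.conjTranspose * D * V).submatrix (Fin.castLE hk) (Fin.castLE hk) := by
    intro D
    rw [hW, conjTranspose_submatrix]
    rfl
  have hWW : W.conjTranspose * W = 1 := by
    have := hWsub 1
    rwa [Matrix.mul_one, Matrix.mul_one, hV, submatrix_one _ hinj] at this
  have hAW : W.conjTranspose * A * W = diagonal fun i => (a (Fin.castLE hk i) : ℂ) := by
    rw [hWsub, hAV, submatrix_diagonal _ _ hinj]; rfl
  have hdet := norm_det_le_det_of_le (A := W.conjTranspose * A * W) (P := W.conjTranspose * P * W)
    (isHermitian_conjTranspose_mul_mul W hA)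
    (by rw [← Matrix.sub_mul, ← Matrix.mul_sub]; exact h1.conjTranspose_mul_mul_same W)
    (by rw [← Matrix.add_mul, ← Matrix.mul_add]; exact h2.conjTranspose_mul_mul_same W)
  rw [hAW, det_diagonal, norm_prod] at hdet
  simp only [Complex.norm_real, Real.norm_eq_abs] at hdet
  refine hdet.trans ?_
  have hPW := hP.conjTranspose_mul_mul_same W
  obtain ⟨O, μ, hO1, hO2, hμ, hμ0, hPO, -⟩ := hPW.exists_antitone_diagonalization
  have hcard : Fintype.card (Fin k) = k := Fintype.card_fin k
  generalize Fintype.card (Fin k) = k' at *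
  subst hcard
  set Z := U.conjTranspose * W * O with hZdef
  have hZc : Z.conjTranspose = O.conjTranspose * W.conjTranspose * U := by
    rw [hZdef, conjTranspose_mul, conjTranspose_mul, conjTranspose_conjTranspose,
      Matrix.mul_assoc]
  have hZ : Z.conjTranspose * Z = 1 := by
    calc Z.conjTranspose * Z
        = O.conjTranspose * (W.conjTranspose * (U * U.conjTranspose) * W) * O := by
          rw [hZc, hZdef]; simp only [Matrix.mul_assoc]
      _ = 1 := by rw [hU2, Matrix.mul_one, hWW, Matrix.mul_one, hO1]
  have hZp : Z.conjTranspose * diagonal (fun i => (p i : ℂ)) * Z =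
      diagonal fun i => (μ i : ℂ) := by
    calc Z.conjTranspose * diagonal (fun i => (p i : ℂ)) * Z
        = O.conjTranspose * (W.conjTranspose * (U * diagonal (fun i => (p i : ℂ)) *
            U.conjTranspose) * W) * O := by
          rw [hZc, hZdef]; simp only [Matrix.mul_assoc]
      _ = (O.conjTranspose * O) * diagonal (fun i => (μ i : ℂ)) * (O.conjTranspose * O) := by
          rw [← hPU, hPO]; simp only [Matrix.mul_assoc]
      _ = _ := by rw [hO1, Matrix.one_mul, Matrix.mul_one]
  have hdetP : (W.conjTranspose * P * W).det = ((∏ i, μ i : ℝ) : ℂ) := by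
    rw [hPO, det_mul, det_mul, mul_right_comm, ← det_mul, hO2, det_one, one_mul, det_diagonal]
    push_cast; rfl
  rw [hdetP, Complex.norm_real, Real.norm_of_nonneg (Finset.prod_nonneg fun i _ => hμ0 i)]
  exact Finset.prod_le_prod (fun i _ => hμ0 i) fun i _ =>
    compression_eigenvalue_le hk Z hZ p μ hp hμ hZp i

end Matrix

/-! ### Direct sums and the block-diagonal majorant -/

namespace Matrix

/-- The direct sum of a family of square matrices of the same size, with the block index first. -/
noncomputable def directSum {m n : ℕ} :
    (Fin m → Matrix (Fin n) (Fin n) ℂ) →ₐ[ℝ] Matrix (Fin m × Fin n) (Fin m × Fin n) ℂ :=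
  AlgHom.ofLinearMap
    { toFun := fun X => of fun p q => if p.1 = q.1 then X p.1 p.2 q.2 else 0
      map_add' := fun X Y => by
        ext p q
        simp only [of_apply, add_apply, Pi.add_apply]
        split_ifs <;> simp
      map_smul' := fun c X => by ext p q; simp }
    (by
      ext p q
      rcases p with ⟨i, a⟩
      rcases q with ⟨j, b⟩
      by_cases h : i = j <;> simp [one_apply, h])
    (fun X Y => by
      ext p q
      simp only [LinearMap.coe_mk, AddHom.coe_mk, of_apply, mul_apply, Pi.mul_apply,
        Fintype.sum_prod_type, ite_mul, zero_mul, mul_ite, mul_zero]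
      by_cases h : p.1 = q.1 <;> simp [h])

theorem directSum_apply {m n : ℕ} (X : Fin m → Matrix (Fin n) (Fin n) ℂ) (i j : Fin m)
    (a b : Fin n) : directSum X (i, a) (j, b) = if i = j then X i a b else 0 := rfl

theorem dotProduct_mulVec_prod {m n : ℕ} (A : Matrix (Fin m × Fin n) (Fin m × Fin n) ℂ)
    (x : Fin m × Fin n → ℂ) :
    star x ⬝ᵥ (A *ᵥ x) = ∑ i, ∑ j,
      star (fun a => x (i, a)) ⬝ᵥ (block A i j *ᵥ fun b => x (j, b)) := by
  simp only [dotProduct, mulVec, Fintype.sum_prod_type, block, of_apply, Pi.star_apply,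
    Finset.mul_sum]
  refine Finset.sum_congr rfl fun i _ => ?_
  rw [Finset.sum_comm]

theorem dotProduct_directSum_mulVec {m n : ℕ} (X : Fin m → Matrix (Fin n) (Fin n) ℂ)
    (x : Fin m × Fin n → ℂ) :
    star x ⬝ᵥ (directSum X *ᵥ x) = ∑ i,
      star (fun a => x (i, a)) ⬝ᵥ (X i *ᵥ fun b => x (i, b)) := by
  rw [dotProduct_mulVec_prod]
  refine Finset.sum_congr rfl fun i _ => ?_
  rw [Finset.sum_eq_single i]
  · congr 2; ext a b; simp [block, directSum_apply]
  · intro j _ hj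
    have : block (directSum X) i j = 0 := by ext a b; simp [block, directSum_apply, hj.symm]
    rw [this, zero_mulVec, dotProduct_zero]
  · simp

theorem directSum_isHermitian {m n : ℕ} {X : Fin m → Matrix (Fin n) (Fin n) ℂ}
    (hX : ∀ i, (X i).IsHermitian) : (directSum X).IsHermitian := by
  ext ⟨i, a⟩ ⟨j, b⟩
  rw [conjTranspose_apply, directSum_apply, directSum_apply]
  by_cases h : i = j
  · subst h; simpa using (hX i).apply a b
  · simp [h, Ne.symm h]

theorem directSum_posSemidef {m n : ℕ} {X : Fin m → Matrix (Fin n) (Fin n) ℂ}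
    (hX : ∀ i, (X i).PosSemidef) : (directSum X).PosSemidef := by
  refine PosSemidef.of_dotProduct_mulVec_nonneg (directSum_isHermitian fun i => (hX i).isHermitian)
    fun x => ?_
  rw [dotProduct_directSum_mulVec]
  exact Finset.sum_nonneg fun i _ => (hX i).dotProduct_mulVec_nonneg _

/-- All spectra involved are finite, so one Lagrange polynomial represents f on them, and
polynomials commute with algebra homomorphisms. -/
theorem cfc_directSum {m n : ℕ} (f : ℝ → ℝ) {X : Fin m → Matrix (Fin n) (Fin n) ℂ}
    (hX : ∀ i, (X i).IsHermitian) : cfc f (directSum X) = directSum fun i => cfc f (X i) := by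
  have hfin : (spectrum ℝ (directSum X) ∪ ⋃ i, spectrum ℝ (X i)).Finite :=
    finite_real_spectrum.union (Set.finite_iUnion fun i => finite_real_spectrum)
  set s := hfin.toFinset
  set p := Lagrange.interpolate s id f
  have hp : ∀ t ∈ s, p.eval t = f t := fun t ht =>
    Lagrange.eval_interpolate_at_node (v := id) f Function.injective_id.injOn ht
  have h1 : cfc f (directSum X) = Polynomial.aeval (directSum X) p := by
    rw [← cfc_polynomial p (directSum X) (directSum_isHermitian hX).isSelfAdjoint]
    exact cfc_congr fun t ht => (hp t (hfin.mem_toFinset.2 (Or.inl ht))).symm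
  have h2 : ∀ i, cfc f (X i) = Polynomial.aeval (X i) p := fun i => by
    rw [← cfc_polynomial p (X i) (hX i).isSelfAdjoint]
    exact cfc_congr fun t ht =>
      (hp t (hfin.mem_toFinset.2 (Or.inr (Set.mem_iUnion.2 ⟨i, ht⟩)))).symm
  rw [h1, Polynomial.aeval_algHom_apply]
  congr 1
  ext1 i
  rw [h2]
  exact (Polynomial.aeval_algHom_apply
    (Pi.evalAlgHom ℝ (fun _ : Fin m => Matrix (Fin n) (Fin n) ℂ) i) X p).symm

theorem star_sumElim {ι κ : Type*} (u : ι → ℂ) (v : κ → ℂ) :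
    star (Sum.elim u v) = Sum.elim (star u) (star v) := by
  ext i; cases i <;> rfl

theorem abs_posSemidef {ι : Type*} [Fintype ι] [DecidableEq ι] (B : Matrix ι ι ℂ) :
    (CFC.abs B).PosSemidef :=
  nonneg_iff_posSemidef.1 (CFC.abs_nonneg B)

/-- The right side is positive semidefinite with square diag(BB*, B*B), so it is the square root. -/
theorem abs_fromBlocks_zero_conjTranspose {ι : Type*} [Fintype ι] [DecidableEq ι]
    (B : Matrix ι ι ℂ) :
    CFC.abs (fromBlocks 0 B B.conjTranspose 0) =
      fromBlocks (CFC.abs B.conjTranspose) 0 0 (CFC.abs B) := by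
  have hpos : (fromBlocks (CFC.abs B.conjTranspose) 0 0 (CFC.abs B)).PosSemidef := by
    refine PosSemidef.of_dotProduct_mulVec_nonneg ?_ fun x => ?_
    · rw [IsHermitian, fromBlocks_conjTranspose, (abs_posSemidef _).isHermitian.eq,
        (abs_posSemidef _).isHermitian.eq, conjTranspose_zero]
    · obtain ⟨u, v, rfl⟩ : ∃ u v, x = Sum.elim u v := ⟨_, _, (Sum.elim_comp_inl_inr x).symm⟩
      rw [fromBlocks_mulVec, star_sumElim]
      simpa using add_nonneg ((abs_posSemidef B.conjTranspose).dotProduct_mulVec_nonneg u)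
        ((abs_posSemidef B).dotProduct_mulVec_nonneg v)
  rw [CFC.abs]
  refine CFC.sqrt_unique ?_ (nonneg_iff_posSemidef.2 hpos)
  rw [star_eq_conjTranspose, fromBlocks_conjTranspose, fromBlocks_multiply, fromBlocks_multiply]
  simp [CFC.abs_mul_abs, star_eq_conjTranspose]

/-- This is ±H ≤ |H| for the Hermitian dilation H of B, tested on the vector (u, v). -/
theorem two_mul_abs_re_le {ι : Type*} [Fintype ι] [DecidableEq ι]
    (B : Matrix ι ι ℂ) (u v : ι → ℂ) :
    2 * |(star u ⬝ᵥ (B *ᵥ v)).re| ≤ (star u ⬝ᵥ (CFC.abs B.conjTranspose *ᵥ u)).re +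
      (star v ⬝ᵥ (CFC.abs B *ᵥ v)).re := by
  have hH : (fromBlocks 0 B B.conjTranspose 0).IsHermitian := by
    rw [IsHermitian, fromBlocks_conjTranspose]; simp
  have hconj : (star v ⬝ᵥ (B.conjTranspose *ᵥ u)).re = (star u ⬝ᵥ (B *ᵥ v)).re := by
    rw [← Complex.conj_re, ← RCLike.star_def, ← star_dotProduct_star, star_star, star_mulVec,
      conjTranspose_conjTranspose, ← dotProduct_mulVec, dotProduct_comm]
  have hquad : ∀ M : Matrix (ι ⊕ ι) (ι ⊕ ι) ℂ, 0 ≤ M →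
      0 ≤ (star (Sum.elim u v) ⬝ᵥ (M *ᵥ Sum.elim u v)).re := fun M hM =>
    (Complex.le_def.1 ((nonneg_iff_posSemidef.1 hM).dotProduct_mulVec_nonneg _)).1
  have h1 := hquad (CFC.abs (fromBlocks 0 B B.conjTranspose 0) - fromBlocks 0 B B.conjTranspose 0)
    (by rw [CFC.abs_sub_self _ hH.isSelfAdjoint]
        exact smul_nonneg zero_le_two (CFC.negPart_nonneg _))
  have h2 := hquad (CFC.abs (fromBlocks 0 B B.conjTranspose 0) + fromBlocks 0 B B.conjTranspose 0)
    (by rw [CFC.abs_add_self _ hH.isSelfAdjoint]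
        exact smul_nonneg zero_le_two (CFC.posPart_nonneg _))
  rw [abs_fromBlocks_zero_conjTranspose, sub_mulVec, fromBlocks_mulVec, fromBlocks_mulVec] at h1
  rw [abs_fromBlocks_zero_conjTranspose, add_mulVec, fromBlocks_mulVec, fromBlocks_mulVec] at h2
  simp only [dotProduct_sub, dotProduct_add, star_sumElim, sumElim_dotProduct_sumElim, zero_mulVec,
    add_zero, zero_add, Complex.sub_re, Complex.add_re, Sum.elim_comp_inl, Sum.elim_comp_inr,
    hconj] at h1 h2
  rcases abs_cases (star u ⬝ᵥ (B *ᵥ v)).re with ⟨h, -⟩ | ⟨h, -⟩ <;> rw [h] <;> linarith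

theorem block_conjTranspose {m n : ℕ} {A : Matrix (Fin m × Fin n) (Fin m × Fin n) ℂ}
    (hA : A.IsHermitian) (i j : Fin m) : (block A i j).conjTranspose = block A j i := by
  ext a b
  exact hA.apply (j, a) (i, b)

/-- The block-diagonal majorant of a Hermitian block matrix. -/
theorem abs_re_dotProduct_mulVec_le {m n : ℕ} {A : Matrix (Fin m × Fin n) (Fin m × Fin n) ℂ}
    (hA : A.IsHermitian) (x : Fin m × Fin n → ℂ) :
    |(star x ⬝ᵥ (A *ᵥ x)).re| ≤
      (star x ⬝ᵥ ((∑ l, directSum fun i => CFC.abs (block A l i)) *ᵥ x)).re := by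
  rw [dotProduct_mulVec_prod, sum_mulVec, dotProduct_sum]
  simp only [dotProduct_directSum_mulVec, Complex.re_sum]
  set y : Fin m → Fin n → ℂ := fun i a => x (i, a)
  set q : Fin m → Fin m → ℝ := fun i j => (star (y j) ⬝ᵥ (CFC.abs (block A i j) *ᵥ y j)).re with hq
  have h1 : ∀ i j, 2 * |(star (y i) ⬝ᵥ (block A i j *ᵥ y j)).re| ≤ q j i + q i j := fun i j => by
    have := two_mul_abs_re_le (block A i j) (y i) (y j)
    rwa [block_conjTranspose hA] at this
  have h2 : |∑ i, ∑ j, (star (y i) ⬝ᵥ (block A i j *ᵥ y j)).re| ≤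
      ∑ i, ∑ j, |(star (y i) ⬝ᵥ (block A i j *ᵥ y j)).re| :=
    (Finset.abs_sum_le_sum_abs _ _).trans
      (Finset.sum_le_sum fun i _ => Finset.abs_sum_le_sum_abs _ _)
  -- Summed over all (i, j), each q occurs twice, cancelling the factor 2.
  have h3 := Finset.sum_le_sum fun i (_ : i ∈ Finset.univ) =>
    Finset.sum_le_sum fun j (_ : j ∈ Finset.univ) => h1 i j
  simp only [Finset.sum_add_distrib, ← Finset.mul_sum] at h3
  rw [Finset.sum_comm (f := fun i j => q j i)] at h3
  change _ ≤ ∑ i, ∑ j, q i j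
  linarith

theorem posSemidef_of_re_nonneg {ι : Type*} [Fintype ι] {M : Matrix ι ι ℂ} (hM : M.IsHermitian)
    (h : ∀ x : ι → ℂ, 0 ≤ (star x ⬝ᵥ (M *ᵥ x)).re) : M.PosSemidef :=
  PosSemidef.of_dotProduct_mulVec_nonneg hM fun x =>
    Complex.le_def.2 ⟨h x, (hM.im_star_dotProduct_mulVec_self x).symm⟩

theorem posSemidef_sub_and_add {m n : ℕ} {A : Matrix (Fin m × Fin n) (Fin m × Fin n) ℂ}
    (hA : A.IsHermitian) :
    ((∑ l, directSum fun i => CFC.abs (block A l i)) - A).PosSemidef ∧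
      ((∑ l, directSum fun i => CFC.abs (block A l i)) + A).PosSemidef := by
  have hP : (∑ l, directSum fun i => CFC.abs (block A l i)).IsHermitian :=
    (posSemidef_sum _ fun l _ => directSum_posSemidef fun i => abs_posSemidef _).isHermitian
  constructor
  · refine posSemidef_of_re_nonneg (hP.sub hA) fun x => ?_
    rw [sub_mulVec, dotProduct_sub, Complex.sub_re]
    linarith [abs_re_dotProduct_mulVec_le hA x, le_abs_self (star x ⬝ᵥ (A *ᵥ x)).re]
  · refine posSemidef_of_re_nonneg (hP.add hA) fun x => ?_
    rw [add_mulVec, dotProduct_add, Complex.add_re]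
    linarith [abs_re_dotProduct_mulVec_le hA x, neg_abs_le (star x ⬝ᵥ (A *ᵥ x)).re]

end Matrix

/-! ### Comparing a direct sum with the sum -/

namespace SymmetricNorm

open Matrix

variable (N : SymmetricNorm)

/-- C C* and C* C have the same characteristic polynomial, hence the same eigenvalues. -/
theorem toFun_mul_conjTranspose_self {ι : Type} [Fintype ι] [DecidableEq ι] (C : Matrix ι ι ℂ) :
    N.toFun ι (C * C.conjTranspose) = N.toFun ι (C.conjTranspose * C) := by
  have h1 := isHermitian_mul_conjTranspose_self C
  have h2 := isHermitian_conjTranspose_mul_self C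
  have he := (h1.eigenvalues_eq_eigenvalues_iff h2).2 (charpoly_mul_comm _ _)
  have key : ∀ {A : Matrix ι ι ℂ} (hA : A.IsHermitian),
      N.toFun ι A = N.toFun ι (diagonal (RCLike.ofReal ∘ hA.eigenvalues)) := by
    intro A hA
    conv_lhs => rw [hA.spectral_theorem, Unitary.conjStarAlgAut_apply]
    exact N.unitarily_invariant ι _ _ _ hA.eigenvectorUnitary.2 (star hA.eigenvectorUnitary).2
  rw [key h1, key h2, he]

/-- Let C have the square roots of the X_i as its block row j₀ and zeros elsewhere. Then C C* is ∑
X_i in block (j₀, j₀) and zero elsewhere, while the diagonal blocks of C* C are the X_i, so ⊕ X_i is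
a pinching of C* C. -/
theorem toFun_directSum_le {m n : ℕ} (hm : 0 < m) {X : Fin m → Matrix (Fin n) (Fin n) ℂ}
    (hX : ∀ i, (X i).PosSemidef) :
    N.toFun (Fin m × Fin n) (directSum X) ≤ N.toFun (Fin n) (∑ i, X i) := by
  have hsqrt : ∀ i, ∃ R : Matrix (Fin n) (Fin n) ℂ, R.conjTranspose = R ∧ R * R = X i := fun i =>
    ⟨CFC.sqrt (X i), (nonneg_iff_posSemidef.1 (CFC.sqrt_nonneg (X i))).isHermitian,
      CFC.sqrt_mul_sqrt_self _ (hX i).nonneg⟩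
  choose R hRs hR using hsqrt
  have hRe : ∀ i a b, R i a b = star (R i b a) := fun i a b => by
    rw [← conjTranspose_apply, hRs]
  set j₀ : Fin m := ⟨0, hm⟩
  set C : Matrix (Fin m × Fin n) (Fin m × Fin n) ℂ :=
    of fun p q => if p.1 = j₀ then R q.1 p.2 q.2 else 0 with hC
  have h1 : directSum X = pinch Prod.fst (C.conjTranspose * C) := by
    ext ⟨i, a⟩ ⟨j, b⟩
    rw [directSum_apply, pinch, of_apply]
    by_cases h : i = j
    · subst h
      simp only [if_true]
      rw [← hR i, mul_apply, mul_apply, Fintype.sum_prod_type,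
        Finset.sum_eq_single j₀ (fun k _ hk => by simp [hC, hk]) (by simp)]
      refine Finset.sum_congr rfl fun b' _ => ?_
      rw [hRe i a b']
      simp [hC]
    · simp [h]
  let e : Fin n ⊕ {p : Fin m × Fin n // p.1 ≠ j₀} ≃ Fin m × Fin n :=
    (Equiv.sumCongr ⟨fun a => (⟨(j₀, a), rfl⟩ : {p : Fin m × Fin n // p.1 = j₀}), fun p => p.1.2,
      fun a => rfl, fun ⟨⟨i, a⟩, (h : i = j₀)⟩ => by simp [h]⟩ (Equiv.refl _)).trans
      (Equiv.sumCompl fun p : Fin m × Fin n => p.1 = j₀)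
  have he1 : ∀ a, e (Sum.inl a) = (j₀, a) := fun a => rfl
  have he2 : ∀ p, e (Sum.inr p) = p.1 := fun p => rfl
  have h2 : C * C.conjTranspose = reindex e e (fromBlocks (∑ i, X i) 0 0 0) := by
    rw [reindex_apply, ← Equiv.symm_symm e, eq_comm, ← reindex_apply, ← Equiv.eq_symm_apply,
      reindex_symm, reindex_apply, Equiv.symm_symm, Equiv.symm_symm]
    ext (a | p) (b | q)
    · rw [fromBlocks_apply₁₁, submatrix_apply, he1, he1, mul_apply, Fintype.sum_prod_type,
        Matrix.sum_apply]
      refine Finset.sum_congr rfl fun i _ => ?_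
      rw [← hR i, mul_apply]
      refine Finset.sum_congr rfl fun c _ => ?_
      rw [hRe i c b]
      simp [hC]
    · simp [he1, he2, hC, mul_apply, q.2]
    · simp [he1, he2, hC, mul_apply, p.2]
    · simp [he2, hC, mul_apply, p.2]
  rw [h1, ← N.direct_sum_zero (Fin n) {p : Fin m × Fin n // p.1 ≠ j₀}, ← N.reindex_eq _ _ e, ← h2,
    N.toFun_mul_conjTranspose_self]
  exact N.toFun_pinch_le _ _

end SymmetricNorm

/-! ### Assembly of the theorem -/

open Matrix in
theorem theorem2p5 (m n : ℕ) (A : Matrix (Fin m × Fin n) (Fin m × Fin n) ℂ)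
    (hA : A.IsHermitian) (f : ℝ → ℝ) (hf_nonneg : ∀ t : ℝ, 0 ≤ t → 0 ≤ f t)
    (hf_concave : ConcaveOn ℝ (Set.Ici 0) f) (hf_econvex : EConvex f) (N : SymmetricNorm) :
    N.toFun (Fin m × Fin n) (funAbs f A) ≤
      N.toFun (Fin n) (∑ i : Fin m, ∑ j : Fin m, funAbs f (block A i j)) := by
  rcases Nat.eq_zero_or_pos m with rfl | hm
  · rw [Subsingleton.elim (funAbs f A) 0, N.toFun_zero]
    exact N.toFun_nonneg _
  have : Nonempty (Fin m) := ⟨⟨0, hm⟩⟩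
  have hmono := hf_concave.monotoneOn_Ici_of_nonneg hf_nonneg
  have habs : ∀ l i, (CFC.abs (block A l i)).PosSemidef := fun l i => abs_posSemidef _
  set Q : Fin m → Matrix (Fin m × Fin n) (Fin m × Fin n) ℂ :=
    fun l => directSum fun i => CFC.abs (block A l i) with hQdef
  have hQ : ∀ l, (Q l).PosSemidef := fun l => directSum_posSemidef (habs l)
  have hP : (∑ l, Q l).PosSemidef := posSemidef_sum _ fun l _ => hQ l
  obtain ⟨hsub, hadd⟩ := posSemidef_sub_and_add hA
  obtain ⟨V, a, hV1, hV2, ha, hAV, hfV⟩ := hA.exists_antitone_abs_diagonalization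
  obtain ⟨U, p, hU1, hU2, hp, hp0, hPU, -⟩ := hP.exists_antitone_diagonalization
  have hAV' : V.conjTranspose * A * V = diagonal fun i => (a i : ℂ) := by
    conv_lhs => rw [hAV]
    simp only [← Matrix.mul_assoc, hV1, Matrix.one_mul]
    rw [Matrix.mul_assoc, hV1, Matrix.mul_one]
  have hPU' : U.conjTranspose * (∑ l, Q l) * U = diagonal fun i => (p i : ℂ) := by
    conv_lhs => rw [hPU]
    simp only [← Matrix.mul_assoc, hU1, Matrix.one_mul]
    rw [Matrix.mul_assoc, hU1, Matrix.mul_one]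
  have hprod := fun k hk =>
    prod_abs_le_prod_of_le hA hsub hadd hP U V a p hV1 hU2 hAV' hPU hp k hk
  set X : Fin m → Matrix (Fin n) (Fin n) ℂ := fun i => ∑ l, funAbs f (block A l i) with hXdef
  have hXpos : ∀ i, (X i).PosSemidef := fun i => posSemidef_sum _ fun l _ =>
    nonneg_iff_posSemidef.1 (cfc_nonneg fun t ht =>
      hf_nonneg t (spectrum_nonneg_of_nonneg (habs l i).nonneg ht))
  have hM : ∑ l, cfc f (Q l) = directSum X := by
    simp only [hQdef, cfc_directSum f fun i => (habs _ i).isHermitian]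
    rw [← map_sum]
    congr 1
    ext1 i
    rw [Finset.sum_apply]; rfl
  set y : Fin (Fintype.card (Fin m × Fin n)) → ℝ :=
    fun j => ((U.conjTranspose * directSum X * U) j j).re with hy
  have hmaj : ∀ (k : ℕ) (hk : k ≤ Fintype.card (Fin m × Fin n)),
      ∑ i : Fin k, f |a (Fin.castLE hk i)| ≤ ∑ i : Fin k, y (Fin.castLE hk i) := by
    intro k hk
    have h1 := hf_econvex.sum_le_sum_of_prod_le hmono (fun i : Fin k => |a (Fin.castLE hk i)|)
      (fun i => p (Fin.castLE hk i)) (fun i j hij => ha ((Fin.castLE_le_castLE_iff hk).2 hij))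
      (fun i => abs_nonneg _) (fun i => hp0 _) (fun k' hk' => hprod k' (hk'.trans hk))
    -- T is the set of the first k indices, which carry the largest p because p is nonincreasing.
    have h2 := sum_concave_eigenvalues_le hf_concave hf_nonneg Q hQ U hU1 hU2 p hp0 hPU'
      (Finset.univ.map (Fin.castLEEmb hk)) (fun j hj i hi => hp (by
        obtain ⟨j', -, rfl⟩ := Finset.mem_map.1 hj
        by_contra! hlt
        exact hi (Finset.mem_map.2 ⟨⟨i, lt_trans hlt j'.2⟩, Finset.mem_univ _, rfl⟩)))
    rw [hM, Finset.sum_map, Finset.sum_map] at h2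
    exact h1.trans h2
  have hnorm1 := N.toFun_diagonal_le_of_sum_le (fun i => f |a i|) y
    (fun i j hij => hmono (Set.mem_Ici.2 (abs_nonneg _)) (Set.mem_Ici.2 (abs_nonneg _)) (ha hij))
    (fun i => hf_nonneg _ (abs_nonneg _)) hmaj
  -- Pinching along `id` keeps only the diagonal; its entries are real because the matrix is
  -- Hermitian.
  have hdiag : diagonal (fun j => (y j : ℂ)) = pinch id (U.conjTranspose * directSum X * U) := by
    have hH := isHermitian_conjTranspose_mul_mul U (directSum_posSemidef hXpos).isHermitian
    ext i j
    by_cases hij : i = j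
    · subst hij
      simp only [diagonal_apply_eq, pinch, of_apply, if_true]
      exact hH.coe_re_apply_self i
    · simp [pinch, hij]
  have e := (Fintype.equivFin (Fin m × Fin n)).symm
  calc N.toFun _ (funAbs f A)
      = N.toFun _ (diagonal fun i => (f |a i| : ℂ)) := by rw [hfV f, N.toFun_conj_eq e V hV1]
    _ ≤ N.toFun _ (diagonal fun j => (y j : ℂ)) := hnorm1
    _ ≤ N.toFun _ (U.conjTranspose * directSum X * U) := by
        rw [hdiag]; exact N.toFun_pinch_le _ _
    _ = N.toFun _ (directSum X) := by
        have := N.toFun_conj_eq e.symm U.conjTranspose (by rwa [conjTranspose_conjTranspose])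
          (directSum X)
        rwa [conjTranspose_conjTranspose] at this
    _ ≤ N.toFun _ (∑ i, X i) := N.toFun_directSum_le hm hXpos
    _ = _ := by rw [hXdef, Finset.sum_comm]
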